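/- Fix a set $\Sigma$ of labels. A weak transition system $X$ consists of a set $X^0$ of states, a set $L$ of actions, a labelling map $\mu:L\to\Sigma$, and for each $n\ge 1$ a set of $n$-transitions $(\alpha,u_1,\dots,u_n,\beta)\in X^0\times L^n\times X^0$, such that (multiset axiom) transitions are stable under permutation of $u_1,\dots,u_n$, and (composition axiom) for $n\ge 3$, $p,q\ge1$, $p+q<n$, if $(\alpha,u_1,\dots,u_n,\beta)$, $(\alpha,u_1,\dots,u_p,\nu_1)$, $(\nu_1,u_{p+1},\dots,u_n,\beta)$, $(\alpha,u_1,\dots,u_{p+q},\nu_2)$ and $(\nu_2,u_{p+q+1},\dots,u_n,\beta)$ are transitions, then so is $(\nu_1,u_{p+1},\dots,u_{p+q},\nu_2)$. A map is a map $f$ on states together with a label-preserving map on actions, taking transitions to transitions. Let $\mathcal{WTS}$ be the resulting category. The system $X$ satisfies the intermediate state axiom (resp. CSA2) if for every transition $(\alpha,u_1,\dots,u_n,\beta)$ and $1\le p<n$ there is a (resp. a unique) state $\nu$ such that $(\alpha,u_1,\dots,u_p,\nu)$ and $(\nu,u_{p+1},\dots,u_n,\beta)$ are transitions. It is cubical (resp.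 regular) if every action $u$ occurs in a $1$-transition $(\alpha,u,\beta)$ and $X$ satisfies the intermediate state axiom (resp. CSA2). Let $\mathcal{RTS}\subset\mathcal{CTS}\subset\mathcal{WTS}$ be the full subcategories of regular and of cubical systems. A set is regarded as a cubical system with that set of states and no actions. (1) If $X$ is cubical, $Y$ is a weak transition system satisfying CSA2 and $f:X\to Y$ is a map which is one-to-one on states, then $X$ is regular. (2) The full subcategory of $\mathcal{WTS}$ of the systems satisfying CSA2 is reflective. Write $\mathrm{CSA}_2:\mathcal{WTS}\to\mathcal{WTS}$ for the reflection (unique up to isomorphism) and $\eta_X:X\to \mathrm{CSA}_2(X)$ for its unit. For every cubical $X$, the map $\eta_X$ is onto on states and bijective on actions; the reflection may be chosen so that $\eta_X$ is the identity on actions for all cubical $X$. (3) If $X$ is cubical (in particular if $X$ is regular), then $\mathrm{CSA}_2(X)$ is regular. (4) $\mathcal{RTS}$ is a full, isomorphism-closed, reflective subcategory of $\mathcal{CTS}$; the restriction $\mathrm{CSA}_2:\mathcal{CTS}\to\mathcal{RTS}$ is left adjoint to the inclusion, with unit the restriction of $\eta$. (5) For every cubical $X$, the square with sides the inclusions of the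 sets of states $X^0\subset X$ and $\mathrm{CSA}_2(X)^0\subset \mathrm{CSA}_2(X)$, and the maps $\eta_X^0:X^0\to\mathrm{CSA}_2(X)^0$ and $\eta_X:X\to \mathrm{CSA}_2(X)$, is a pushout square in $\mathcal{CTS}$. -/

import Mathlib

open CategoryTheory

universe v u

/-- A weak transition system over the set of labels `Lab`. An `n`-transition
`(α, u₁, …, uₙ, β)`, `n ≥ 1`, is encoded as `Tr α [u₁, …, uₙ] β`; the empty list carries no
transition. Being invariant under `List.Perm` is invariance under all permutations of
`u₁, …, uₙ`. -/
structure WeakTransitionSystem (Lab : Type v) where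
  /-- the set of states -/
  State : Type u
  /-- the set of actions -/
  Action : Type u
  /-- the labelling map -/
  label : Action → Lab
  /-- the set of transitions -/
  Tr : State → List Action → State → Prop
  /-- all transitions have dimension at least one -/
  ne_nil_of_tr : ∀ {α us β}, Tr α us β → us ≠ []
  /-- the multiset axiom -/
  multiset : ∀ {α us vs β}, us.Perm vs → Tr α us β → Tr α vs β
  /-- the composition axiom -/
  composition : ∀ {α us vs ws β ν₁ ν₂}, us ≠ [] → vs ≠ [] → ws ≠ [] →
    Tr α (us ++ vs ++ ws) β →
    Tr α us ν₁ → Tr ν₁ (vs ++ ws) β →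
    Tr α (us ++ vs) ν₂ → Tr ν₂ ws β →
    Tr ν₁ vs ν₂

namespace WeakTransitionSystem

variable {Lab : Type v}

/-- Maps of weak transition systems: a map on states and a label-preserving map on actions,
which together send transitions to transitions. -/
@[ext]
structure Hom (X Y : WeakTransitionSystem.{v, u} Lab) where
  /-- the map on states -/
  onStates : X.State → Y.State
  /-- the map on actions -/
  onActions : X.Action → Y.Action
  label_onActions : ∀ u, Y.label (onActions u) = X.label u
  map_tr : ∀ {α us β}, X.Tr α us β → Y.Tr (onStates α) (us.map onActions) (onStates β)

/-- The category of weak transition systems. -/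
instance : Category.{u} (WeakTransitionSystem.{v, u} Lab) where
  Hom := Hom
  id X :=
    { onStates := id
      onActions := id
      label_onActions := fun _ => rfl
      map_tr := fun h => by simpa using h }
  comp f g :=
    { onStates := g.onStates ∘ f.onStates
      onActions := g.onActions ∘ f.onActions
      label_onActions := fun u => (g.label_onActions _).trans (f.label_onActions u)
      map_tr := fun h => by simpa using g.map_tr (f.map_tr h) }

/-- All actions are used: every action occurs in a 1-transition. -/
def AllActionsUsed (X : WeakTransitionSystem.{v, u} Lab) : Prop :=
  ∀ u : X.Action, ∃ α β, X.Tr α [u] β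

/-- The intermediate state axiom. -/
def IntermediateState (X : WeakTransitionSystem.{v, u} Lab) : Prop :=
  ∀ (α β : X.State) (us vs : List X.Action), us ≠ [] → vs ≠ [] → X.Tr α (us ++ vs) β →
    ∃ ν, X.Tr α us ν ∧ X.Tr ν vs β

variable (Lab) in
/-- The unique intermediate state axiom, also called CSA2. -/
def csa2 : ObjectProperty (WeakTransitionSystem.{v, u} Lab) := fun X =>
  ∀ (α β : X.State) (us vs : List X.Action), us ≠ [] → vs ≠ [] → X.Tr α (us ++ vs) β →
    ∃! ν, X.Tr α us ν ∧ X.Tr ν vs β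

variable (Lab) in
/-- Cubical transition systems. -/
def cubical : ObjectProperty (WeakTransitionSystem.{v, u} Lab) := fun X =>
  X.AllActionsUsed ∧ X.IntermediateState

variable (Lab) in
/-- Regular transition systems. -/
def regular : ObjectProperty (WeakTransitionSystem.{v, u} Lab) := fun X =>
  X.AllActionsUsed ∧ csa2 Lab X

theorem regular_le_cubical : regular.{v, u} Lab ≤ cubical Lab := fun _ hX =>
  ⟨hX.1, fun α β us vs hus hvs h => (hX.2 α β us vs hus hvs h).exists⟩

/-- A set seen as a transition system without actions and without transitions. -/
def ofSet (S : Type u) : WeakTransitionSystem.{v, u} Lab where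
  State := S
  Action := PEmpty
  label := PEmpty.elim
  Tr _ _ _ := False
  ne_nil_of_tr h := h.elim
  multiset _ h := h
  composition _ _ _ h _ _ _ _ := h

theorem cubical_ofSet (S : Type u) : cubical Lab (ofSet.{v, u} S) :=
  ⟨fun u => u.elim, fun _ _ _ _ _ _ h => h.elim⟩

end WeakTransitionSystem

open WeakTransitionSystem

/-- The category of weak transition systems. -/
abbrev WTS (Lab : Type v) := WeakTransitionSystem.{v, u} Lab

/-- The category of weak transition systems satisfying CSA2, as a full subcategory of `WTS`. -/
abbrev WTSCSA2 (Lab : Type v) := (csa2.{v, u} Lab).FullSubcategory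

/-- The category of cubical transition systems, as a full subcategory of `WTS`. -/
abbrev CTS (Lab : Type v) := (cubical.{v, u} Lab).FullSubcategory

/-- The category of regular transition systems, as a full subcategory of `WTS`. -/
abbrev RTS (Lab : Type v) := (regular.{v, u} Lab).FullSubcategory

/-- The inclusion functor `RTS ⥤ CTS`. -/
abbrev inclRTS (Lab : Type v) : RTS.{v, u} Lab ⥤ CTS.{v, u} Lab :=
  ObjectProperty.ιOfLE regular_le_cubical

/-- The functor `X ↦ X⁰` taking a cubical transition system to its set of states, seen as a
cubical transition system without actions and transitions. -/
def stateFunctor (Lab : Type v) : CTS.{v, u} Lab ⥤ CTS.{v, u} Lab where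
  obj X := ⟨ofSet X.obj.State, cubical_ofSet _⟩
  map f := ObjectProperty.homMk
    { onStates := f.hom.onStates
      onActions := PEmpty.elim
      label_onActions := fun u => u.elim
      map_tr := fun h => h.elim }
  map_id X := by
    ext : 1
    refine Hom.ext rfl ?_
    funext u
    exact u.elim
  map_comp f g := by
    ext : 1
    refine Hom.ext rfl ?_
    funext u
    exact u.elim

/-- The inclusion `X⁰ ⊂ X`, natural in the cubical transition system `X`. -/
def stateInclusion (Lab : Type v) : stateFunctor.{v, u} Lab ⟶ 𝟭 (CTS.{v, u} Lab) where
  app X := ObjectProperty.homMk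
    { onStates := id
      onActions := PEmpty.elim
      label_onActions := fun u => u.elim
      map_tr := fun h => h.elim }
  naturality X Y f := by
    ext : 1
    refine Hom.ext rfl ?_
    funext u
    exact u.elim

/-!
The reflection onto the systems satisfying CSA2 is built for an arbitrary system `X` from formal
states: those of `X` and, iteratively, one formal intermediate state for each splitting of each
transition. A formal state has a value under any map from `X` to a system `Y` satisfying CSA2, because
intermediate states in `Y` exist and are unique. Equality of formal states, and the transitions
between them, are declared to hold when they hold under all such maps; the axioms of `freeCSA2 X`, and CSA2,
are then inherited from the systems `Y`, and the universal property (`freeCSA2.eq_desc`) follows by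
induction on formal states. The actions of `freeCSA2 X` are those of `X`.

Everything about cubical systems follows from the universal property alone, hence holds for every
choice of the reflection. Given a universal map `φ : X ⟶ Y` with `X` cubical, let `image φ` have the
image of `φ` as its states, the actions of `X`, and the transitions generated by those of `X` under
the multiset and composition axioms. The intermediate state axiom is preserved by this generation
(`intermediateState_image`), and `image φ` maps to `Y` injectively on states, so it is regular by
`regular_of_injective_onStates`. Universality of `φ` now forces `image φ ≅ Y`
(`IsCSA2Reflection.exists_iso_image`). Hence `Y` is regular, `φ` is onto on states and bijective on
actions, and a map out of `Y` amounts to a map out of `X` with a compatible map on the states of `Y`,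
which is the pushout property.
-/

namespace WeakTransitionSystem

variable {Lab : Type v}

/-! ### Maps of weak transition systems -/

theorem hom_ext {X Y : WTS.{v, u} Lab} {f g : X ⟶ Y} (hs : ∀ x, f.onStates x = g.onStates x)
    (ha : ∀ a, f.onActions a = g.onActions a) : f = g :=
  Hom.ext (funext hs) (funext ha)

theorem onStates_eq_of_eq {X Y : WTS.{v, u} Lab} {f g : X ⟶ Y} (h : f = g) (x : X.State) :
    f.onStates x = g.onStates x := by rw [h]

theorem onActions_eq_of_eq {X Y : WTS.{v, u} Lab} {f g : X ⟶ Y} (h : f = g) (a : X.Action) :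
    f.onActions a = g.onActions a := by rw [h]

theorem regular_of_injective_onStates {X Y : WTS.{v, u} Lab} (hX : cubical Lab X)
    (hY : csa2 Lab Y) (f : X ⟶ Y) (hf : Function.Injective f.onStates) : regular Lab X := by
  refine ⟨hX.1, fun α β us vs hus hvs h => ?_⟩
  obtain ⟨ν, h₁, h₂⟩ := hX.2 α β us vs hus hvs h
  refine ⟨ν, ⟨h₁, h₂⟩, fun ν' h' => hf ?_⟩
  have hY' := hY (f.onStates α) (f.onStates β) (us.map f.onActions) (vs.map f.onActions)
    (by simpa using hus) (by simpa using hvs) (by simpa using f.map_tr h)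
  exact hY'.unique ⟨f.map_tr h'.1, f.map_tr h'.2⟩ ⟨f.map_tr h₁, f.map_tr h₂⟩

instance isClosedUnderIsomorphisms_regular :
    (regular.{v, u} Lab).IsClosedUnderIsomorphisms where
  of_iso {X Y} e hX := by
    have hs : ∀ y, e.hom.onStates (e.inv.onStates y) = y :=
      fun y => onStates_eq_of_eq e.inv_hom_id y
    have ha : ∀ a, e.hom.onActions (e.inv.onActions a) = a :=
      fun a => onActions_eq_of_eq e.inv_hom_id a
    have hl : ∀ us : List Y.Action, (us.map e.inv.onActions).map e.hom.onActions = us := by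
      intro us
      simp [Function.comp_def, ha]
    refine regular_of_injective_onStates (Y := X) ⟨fun a => ?_, fun α β us vs hus hvs h => ?_⟩
      hX.2 e.inv (Function.LeftInverse.injective hs)
    · obtain ⟨α, β, h⟩ := hX.1 (e.inv.onActions a)
      exact ⟨_, _, by simpa [ha] using e.hom.map_tr h⟩
    · obtain ⟨ν, ⟨h₁, h₂⟩, -⟩ := hX.2 (e.inv.onStates α) (e.inv.onStates β)
        (us.map e.inv.onActions) (vs.map e.inv.onActions) (by simpa using hus)
        (by simpa using hvs) (by simpa using e.inv.map_tr h)
      have h₁' := e.hom.map_tr h₁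
      have h₂' := e.hom.map_tr h₂
      rw [hl, hs] at h₁' h₂'
      exact ⟨_, h₁', h₂'⟩

/-! ### The free system satisfying CSA2 -/

/-- Formal states over `X`: the states of `X`, and formal intermediate states
`mid α us vs β` of a transition from `α` to `β` with actions `us ++ vs`. Ill-formed intermediate
states, for which no such transition exists, are excluded later by `Term.WellFormed`. -/
inductive Term (X : WTS.{v, u} Lab) : Type u
  | base (s : X.State) : Term X
  | mid (α : Term X) (us vs : List X.Action) (β : Term X) : Term X

namespace Term

variable {X : WTS.{v, u} Lab}

open Classical in
/-- The value of a formal state in the target of a map `f : X ⟶ Y`. A formal intermediate state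
is sent to an intermediate state of `Y`; when there is none, the value of the source state serves
as a default, which never matters for well-formed terms. -/
noncomputable def eval {Y : WTS.{v, u} Lab} (f : X ⟶ Y) : Term X → Y.State
  | base s => f.onStates s
  | mid α us vs β =>
    if h : ∃ ν, Y.Tr (α.eval f) (us.map f.onActions) ν ∧ Y.Tr ν (vs.map f.onActions) (β.eval f)
    then h.choose else α.eval f

/-- The transitions between formal states that hold in every system satisfying CSA2 under `X`. -/
def Tr (p : Term X) (us : List X.Action) (q : Term X) : Prop :=
  us ≠ [] ∧ ∀ (Y : WTS.{v, u} Lab) (_ : csa2 Lab Y) (f : X ⟶ Y),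
    Y.Tr (p.eval f) (us.map f.onActions) (q.eval f)

/-- A formal state is well-formed if each formal intermediate state in it comes from a
transition. -/
def WellFormed : Term X → Prop
  | base _ => True
  | mid α us vs β => α.WellFormed ∧ β.WellFormed ∧ us ≠ [] ∧ vs ≠ [] ∧ α.Tr (us ++ vs) β

theorem eval_mid {Y : WTS.{v, u} Lab} (hY : csa2 Lab Y) (f : X ⟶ Y) {α β : Term X}
    {us vs : List X.Action} (hus : us ≠ []) (hvs : vs ≠ []) (h : α.Tr (us ++ vs) β) :
    Y.Tr (α.eval f) (us.map f.onActions) ((mid α us vs β).eval f) ∧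
      Y.Tr ((mid α us vs β).eval f) (vs.map f.onActions) (β.eval f) := by
  have hex := (hY _ _ (us.map f.onActions) (vs.map f.onActions) (by simpa using hus)
    (by simpa using hvs) (by simpa using h.2 Y hY f)).exists
  rw [eval, dif_pos hex]
  exact hex.choose_spec

theorem eq_eval_mid {Y : WTS.{v, u} Lab} (hY : csa2 Lab Y) (f : X ⟶ Y) {α β : Term X}
    {us vs : List X.Action} (hus : us ≠ []) (hvs : vs ≠ []) (h : α.Tr (us ++ vs) β)
    {ν : Y.State} (h₁ : Y.Tr (α.eval f) (us.map f.onActions) ν)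
    (h₂ : Y.Tr ν (vs.map f.onActions) (β.eval f)) : ν = (mid α us vs β).eval f :=
  (hY _ _ (us.map f.onActions) (vs.map f.onActions) (by simpa using hus)
    (by simpa using hvs) (by simpa using h.2 Y hY f)).unique ⟨h₁, h₂⟩
    (eval_mid hY f hus hvs h)

variable (X) in
/-- Two formal states are identified when they agree in every system satisfying CSA2
under `X`. -/
def setoid : Setoid {p : Term X // p.WellFormed} where
  r p q := ∀ (Y : WTS.{v, u} Lab) (_ : csa2 Lab Y) (f : X ⟶ Y), p.1.eval f = q.1.eval f
  iseqv :=
    { refl := fun _ _ _ _ => rfl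
      symm := fun h Y hY f => (h Y hY f).symm
      trans := fun h h' Y hY f => (h Y hY f).trans (h' Y hY f) }

end Term

/-- The reflection of `X` onto the systems satisfying CSA2: well-formed formal states, with the
identifications and the transitions that hold in every system satisfying CSA2 under `X`. Its
actions are those of `X`. -/
def freeCSA2 (X : WTS.{v, u} Lab) : WTS.{v, u} Lab where
  State := Quotient (Term.setoid X)
  Action := X.Action
  label := X.label
  Tr a us b := Quotient.liftOn₂ a b (fun p q => p.1.Tr us q.1) <| by
    intro p q p' q' hp hq
    refine propext (and_congr Iff.rfl (forall_congr' fun Y => forall_congr' fun hY =>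
      forall_congr' fun f => ?_))
    rw [hp Y hY f, hq Y hY f]
  ne_nil_of_tr {a us b} h := by
    induction a, b using Quotient.inductionOn₂ with | _ p q
    exact h.1
  multiset {a us vs b} hp h := by
    induction a, b using Quotient.inductionOn₂ with | _ p q
    exact ⟨fun h0 => h.1 (by subst h0; exact hp.eq_nil),
      fun Y hY f => Y.multiset (hp.map _) (h.2 Y hY f)⟩
  composition {a us vs ws b c d} hus hvs hws h h₁ h₂ h₃ h₄ := by
    induction a, b using Quotient.inductionOn₂ with | _ p q
    induction c, d using Quotient.inductionOn₂ with | _ r s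
    refine ⟨hvs, fun Y hY f => ?_⟩
    refine Y.composition (us := us.map f.onActions) (vs := vs.map f.onActions)
      (ws := ws.map f.onActions) (by simpa using hus) (by simpa using hvs) (by simpa using hws)
      ?_ (h₁.2 Y hY f) ?_ ?_ (h₄.2 Y hY f)
    · simpa using h.2 Y hY f
    · simpa using h₂.2 Y hY f
    · simpa using h₃.2 Y hY f

theorem csa2_freeCSA2 (X : WTS.{v, u} Lab) : csa2 Lab (freeCSA2 X) := by
  intro a b us vs hus hvs h
  induction a, b using Quotient.inductionOn₂ with | _ p q
  have h' : p.1.Tr (us ++ vs) q.1 := h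
  refine ⟨Quotient.mk _ ⟨.mid p.1 us vs q.1, p.2, q.2, hus, hvs, h'⟩,
    ⟨⟨hus, fun Y hY f => (Term.eval_mid hY f hus hvs h').1⟩,
      ⟨hvs, fun Y hY f => (Term.eval_mid hY f hus hvs h').2⟩⟩, ?_⟩
  intro c hc
  induction c using Quotient.inductionOn with | _ r
  refine Quotient.sound fun Y hY f => ?_
  exact Term.eq_eval_mid hY f hus hvs h' (hc.1.2 Y hY f) (hc.2.2 Y hY f)

/-- The unit of the reflection. -/
def freeCSA2.unit (X : WTS.{v, u} Lab) : X ⟶ freeCSA2 X where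
  onStates s := Quotient.mk _ ⟨.base s, trivial⟩
  onActions := id
  label_onActions _ := rfl
  map_tr {α us β} h := by
    have h' : (Term.base α).Tr us (.base β) := ⟨X.ne_nil_of_tr h, fun Y _ f => f.map_tr h⟩
    rwa [← List.map_id us] at h'

/-- The factorization through the reflection of a map to a system satisfying CSA2. -/
noncomputable def freeCSA2.desc {X Y : WTS.{v, u} Lab} (hY : csa2 Lab Y) (f : X ⟶ Y) :
    freeCSA2 X ⟶ Y where
  onStates := Quotient.lift (fun p => p.1.eval f) fun _ _ h => h Y hY f
  onActions := f.onActions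
  label_onActions := f.label_onActions
  map_tr {a us b} h := by
    induction a, b using Quotient.inductionOn₂ with | _ p q
    exact h.2 Y hY f

theorem freeCSA2.unit_desc {X Y : WTS.{v, u} Lab} (hY : csa2 Lab Y) (f : X ⟶ Y) :
    unit X ≫ desc hY f = f := rfl

/-- A well-formed intermediate state is determined by its source and target because the target
system satisfies CSA2; uniqueness of the factorization follows by induction on terms. -/
theorem freeCSA2.eq_desc {X Y : WTS.{v, u} Lab} (hY : csa2 Lab Y) {f : X ⟶ Y}
    (g : freeCSA2 X ⟶ Y) (hg : unit X ≫ g = f) : g = desc hY f := by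
  have ha : g.onActions = f.onActions := by rw [← hg]; rfl
  have key : ∀ (p : Term X) (hp : p.WellFormed), g.onStates (Quotient.mk _ ⟨p, hp⟩) = p.eval f := by
    intro p
    induction p with
    | base s => exact fun _ => onStates_eq_of_eq hg s
    | mid α us vs β ihα ihβ =>
      rintro ⟨hα, hβ, hus, hvs, h⟩
      have h₁ : (freeCSA2 X).Tr (Quotient.mk _ ⟨α, hα⟩) us
          (Quotient.mk _ ⟨.mid α us vs β, hα, hβ, hus, hvs, h⟩) :=
        ⟨hus, fun Y hY f => (Term.eval_mid hY f hus hvs h).1⟩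
      have h₂ : (freeCSA2 X).Tr (Quotient.mk _ ⟨.mid α us vs β, hα, hβ, hus, hvs, h⟩) vs
          (Quotient.mk _ ⟨β, hβ⟩) :=
        ⟨hvs, fun Y hY f => (Term.eval_mid hY f hus hvs h).2⟩
      have h₁' := g.map_tr h₁
      have h₂' := g.map_tr h₂
      rw [ihα, ha] at h₁'
      rw [ihβ, ha] at h₂'
      exact Term.eq_eval_mid hY f hus hvs h h₁' h₂'
  refine hom_ext (fun a => ?_) (fun a => congrFun ha a)
  induction a using Quotient.inductionOn with | _ p
  exact key p.1 p.2

/-- The universal property of `freeCSA2 X`, as a bijection of sets of maps. -/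
noncomputable def freeCSA2.homEquiv (X : WTS.{v, u} Lab) (Y : WTSCSA2.{v, u} Lab) :
    ((⟨freeCSA2 X, csa2_freeCSA2 X⟩ : WTSCSA2.{v, u} Lab) ⟶ Y) ≃
      (X ⟶ (csa2.{v, u} Lab).ι.obj Y) where
  toFun g := unit X ≫ g.hom
  invFun f := ObjectProperty.homMk (desc Y.property f)
  left_inv g := by
    ext : 1
    exact (eq_desc Y.property g.hom rfl).symm
  right_inv f := unit_desc Y.property f

variable (Lab) in
/-- The reflection of weak transition systems onto those satisfying CSA2. -/
noncomputable def csa2Reflector : WTS.{v, u} Lab ⥤ WTSCSA2.{v, u} Lab :=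
  Adjunction.leftAdjointOfEquiv (G := (csa2.{v, u} Lab).ι) freeCSA2.homEquiv
    (fun _ _ _ _ _ => rfl)

variable (Lab) in
/-- The adjunction making `csa2Reflector` a reflection. -/
noncomputable def csa2Adjunction : csa2Reflector.{v, u} Lab ⊣ (csa2.{v, u} Lab).ι :=
  Adjunction.adjunctionOfEquivLeft (G := (csa2.{v, u} Lab).ι) freeCSA2.homEquiv
    (fun _ _ _ _ _ => rfl)

theorem onActions_csa2Adjunction_unit (X : WTS.{v, u} Lab) (a : X.Action) :
    ((csa2Adjunction Lab).unit.app X).onActions a = a := rfl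

/-! ### The image of a cubical system -/

/-- The transitions on the image of `φ` on states, with the actions of `X`, generated by the
transitions of `X` under the multiset and composition axioms. -/
inductive ImageTr {X Y : WTS.{v, u} Lab} (φ : X ⟶ Y) :
    Set.range φ.onStates → List X.Action → Set.range φ.onStates → Prop
  | of {α us β} : X.Tr α us β → ImageTr φ ⟨_, α, rfl⟩ us ⟨_, β, rfl⟩
  | perm {α us vs β} : us.Perm vs → ImageTr φ α us β → ImageTr φ α vs β
  | comp {α us vs ws β ν₁ ν₂} : us ≠ [] → vs ≠ [] → ws ≠ [] →
      ImageTr φ α (us ++ vs ++ ws) β → ImageTr φ α us ν₁ → ImageTr φ ν₁ (vs ++ ws) β →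
      ImageTr φ α (us ++ vs) ν₂ → ImageTr φ ν₂ ws β → ImageTr φ ν₁ vs ν₂

/-- The weak transition system generated by the image of `φ` on states. -/
def image {X Y : WTS.{v, u} Lab} (φ : X ⟶ Y) : WTS.{v, u} Lab where
  State := Set.range φ.onStates
  Action := X.Action
  label := X.label
  Tr := ImageTr φ
  ne_nil_of_tr h := by
    induction h with
    | of h => exact X.ne_nil_of_tr h
    | perm hp _ ih => exact fun h0 => ih (by subst h0; exact hp.eq_nil)
    | comp _ hvs => exact hvs
  multiset := .perm
  composition := .comp

section Image

variable {X Y : WTS.{v, u} Lab} (φ : X ⟶ Y)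

/-- The corestriction of `φ` to its image. -/
def toImage : X ⟶ image φ where
  onStates s := ⟨_, s, rfl⟩
  onActions := id
  label_onActions _ := rfl
  map_tr {α us β} h := by
    have h' : ImageTr φ ⟨_, α, rfl⟩ us ⟨_, β, rfl⟩ := .of h
    rwa [← List.map_id us] at h'

theorem surjective_onStates_toImage : Function.Surjective (toImage φ).onStates := by
  rintro ⟨_, s, rfl⟩
  exact ⟨s, rfl⟩

/-- A map out of the image is a map out of `X` together with a compatible map on states. -/
def imageDesc {Z : WTS.{v, u} Lab} (g : X ⟶ Z) (k : Set.range φ.onStates → Z.State)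
    (hk : ∀ s, k ⟨_, s, rfl⟩ = g.onStates s) : image φ ⟶ Z where
  onStates := k
  onActions := g.onActions
  label_onActions := g.label_onActions
  map_tr h := by
    change ImageTr φ _ _ _ at h
    induction h with
    | of h =>
      rw [hk, hk]
      exact g.map_tr h
    | perm hp _ ih => exact Z.multiset (hp.map _) ih
    | comp hus hvs hws _ _ _ _ _ ih ih₁ ih₂ ih₃ ih₄ =>
      erw [List.map_append] at ih₂ ih₃
      erw [List.map_append, List.map_append] at ih
      exact Z.composition (mt List.map_eq_nil_iff.1 hus) (mt List.map_eq_nil_iff.1 hvs)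
        (mt List.map_eq_nil_iff.1 hws) ih ih₁ ih₂ ih₃ ih₄

/-- The inclusion of the image. -/
def imageInclusion : image φ ⟶ Y :=
  imageDesc φ φ Subtype.val fun _ => rfl

theorem toImage_imageInclusion : toImage φ ≫ imageInclusion φ = φ := rfl

/-- The intermediate state axiom survives the generation of new transitions by composition: an
intermediate state of the composite is found on the longer transition `α → ν₂`, and a further
application of the composition axiom joins it to `ν₁`. -/
theorem intermediateState_image (hX : X.IntermediateState) :
    (image φ).IntermediateState := by
  -- The splitting is generalized up to permutation, so that the multiset axiom is harmless.
  have key : ∀ {α ts β}, ImageTr φ α ts β → ∀ us vs, us ≠ [] → vs ≠ [] → ts.Perm (us ++ vs) →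
      ∃ ν, ImageTr φ α us ν ∧ ImageTr φ ν vs β := by
    intro α ts β h
    induction h with
    | of h =>
      intro us vs hus hvs hp
      obtain ⟨ν, h₁, h₂⟩ := hX _ _ us vs hus hvs (X.multiset hp h)
      exact ⟨_, .of h₁, .of h₂⟩
    | perm hq _ ih => exact fun us vs hus hvs hp => ih us vs hus hvs (hq.trans hp)
    | @comp α us vs ws β ν₁ ν₂ hus hvs hws h h₁ h₂ h₃ h₄ ih ih₁ ih₂ ih₃ ih₄ =>
      intro vs₁ vs₂ hvs₁ hvs₂ hp
      have hp' : (us ++ vs).Perm (us ++ vs₁ ++ vs₂) := by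
        rw [List.append_assoc]
        exact hp.append_left us
      obtain ⟨ν, h₅, h₆⟩ := ih₃ (us ++ vs₁) vs₂ (by simp [hus]) hvs₂ hp'
      exact ⟨ν, .comp hus hvs₁ hvs₂ (.perm hp' h₃) h₁ (.perm hp (.comp hus hvs hws h h₁ h₂ h₃ h₄))
        h₅ h₆, h₆⟩
  exact fun α β us vs hus hvs h => key h us vs hus hvs (.refl _)

theorem regular_image (hX : cubical Lab X) (hY : csa2 Lab Y) : regular Lab (image φ) :=
  regular_of_injective_onStates
    ⟨fun a => let ⟨_, _, h⟩ := hX.1 a; ⟨_, _, .of h⟩, intermediateState_image φ hX.2⟩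
    hY (imageInclusion φ) Subtype.val_injective

end Image

/-! ### Reflections of cubical systems -/

/-- `φ : X ⟶ Y` is a universal map from `X` to a system satisfying CSA2. -/
structure IsCSA2Reflection {X Y : WTS.{v, u} Lab} (φ : X ⟶ Y) : Prop where
  csa2_target : csa2 Lab Y
  exists_fac : ∀ {W : WTS.{v, u} Lab}, csa2 Lab W → ∀ f : X ⟶ W, ∃ g : Y ⟶ W, φ ≫ g = f
  hom_ext : ∀ {W : WTS.{v, u} Lab}, csa2 Lab W → ∀ g g' : Y ⟶ W, φ ≫ g = φ ≫ g' → g = g'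

theorem isCSA2Reflection_unit {L : WTS.{v, u} Lab ⥤ WTSCSA2.{v, u} Lab}
    (adj : L ⊣ (csa2.{v, u} Lab).ι) (X : WTS.{v, u} Lab) :
    IsCSA2Reflection (adj.unit.app X) where
  csa2_target := (L.obj X).property
  exists_fac {W} hW f := by
    refine ⟨((adj.homEquiv X ⟨W, hW⟩).symm f).hom, ?_⟩
    have h := (adj.homEquiv X ⟨W, hW⟩).apply_symm_apply f
    rw [adj.homEquiv_unit] at h
    exact h
  hom_ext {W} hW g g' h := by
    have h' : (ObjectProperty.homMk g : L.obj X ⟶ (⟨W, hW⟩ : WTSCSA2.{v, u} Lab)) =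
        ObjectProperty.homMk g' := by
      apply (adj.homEquiv X ⟨W, hW⟩).injective
      rw [adj.homEquiv_unit, adj.homEquiv_unit]
      exact h
    exact congrArg (fun k => k.hom) h'

namespace IsCSA2Reflection

variable {X Y : WTS.{v, u} Lab} {φ : X ⟶ Y}

/-- The image of a cubical system in its reflection satisfies CSA2, so that the reflection retracts
onto it; by universality it is the whole reflection. -/
theorem exists_iso_image (hφ : IsCSA2Reflection φ) (hX : cubical Lab X) :
    ∃ e : Y ≅ image φ, φ ≫ e.hom = toImage φ ∧ e.inv = imageInclusion φ := by
  obtain ⟨r, hr⟩ := hφ.exists_fac (regular_image φ hX hφ.csa2_target).2 (toImage φ)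
  have h₁ : r ≫ imageInclusion φ = 𝟙 Y := by
    apply hφ.hom_ext hφ.csa2_target
    rw [← Category.assoc, hr, toImage_imageInclusion, Category.comp_id]
  have h₂ : imageInclusion φ ≫ r = 𝟙 (image φ) := by
    have h : toImage φ ≫ imageInclusion φ ≫ r = toImage φ := by
      rw [← Category.assoc, toImage_imageInclusion, hr]
    refine WeakTransitionSystem.hom_ext (fun x => ?_) (fun a => onActions_eq_of_eq h a)
    obtain ⟨s, rfl⟩ := surjective_onStates_toImage φ x
    exact onStates_eq_of_eq h s
  exact ⟨⟨r, imageInclusion φ, h₁, h₂⟩, hr, rfl⟩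

theorem regular_target (hφ : IsCSA2Reflection φ) (hX : cubical Lab X) : regular Lab Y := by
  obtain ⟨e, -, -⟩ := hφ.exists_iso_image hX
  exact (regular Lab).prop_of_iso e.symm (regular_image φ hX hφ.csa2_target)

theorem surjective_onStates (hφ : IsCSA2Reflection φ) (hX : cubical Lab X) :
    Function.Surjective φ.onStates := by
  obtain ⟨e, -, he⟩ := hφ.exists_iso_image hX
  intro y
  obtain ⟨s, hs⟩ := (e.hom.onStates y).2
  refine ⟨s, hs.trans ?_⟩
  have h := onStates_eq_of_eq e.hom_inv_id y
  rw [he] at h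
  exact h

theorem bijective_onActions (hφ : IsCSA2Reflection φ) (hX : cubical Lab X) :
    Function.Bijective φ.onActions := by
  obtain ⟨e, he, he'⟩ := hφ.exists_iso_image hX
  refine Function.bijective_iff_has_inverse.2
    ⟨e.hom.onActions, fun a => onActions_eq_of_eq he a, fun a => ?_⟩
  have h := onActions_eq_of_eq e.hom_inv_id a
  rw [he'] at h
  exact h

/-- Since the transitions of the reflection are generated by those of `X`, a map out of `X` extends
along `φ` to any system, not only to those satisfying CSA2, as soon as it does on states. -/
theorem exists_extension (hφ : IsCSA2Reflection φ) (hX : cubical Lab X) {Z : WTS.{v, u} Lab}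
    (g : X ⟶ Z) (k : Y.State → Z.State) (hk : ∀ s, k (φ.onStates s) = g.onStates s) :
    ∃ h : Y ⟶ Z, φ ≫ h = g ∧ h.onStates = k := by
  obtain ⟨e, he, he'⟩ := hφ.exists_iso_image hX
  refine ⟨e.hom ≫ imageDesc φ g (fun x => k x.1) hk, ?_, funext fun y => ?_⟩
  · rw [← Category.assoc, he]
    exact WeakTransitionSystem.hom_ext hk fun _ => rfl
  · have h := onStates_eq_of_eq e.hom_inv_id y
    rw [he'] at h
    exact congrArg k h

theorem epi (hφ : IsCSA2Reflection φ) (hX : cubical Lab X) {Z : WTS.{v, u} Lab}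
    {g g' : Y ⟶ Z} (h : φ ≫ g = φ ≫ g') : g = g' := by
  refine WeakTransitionSystem.hom_ext (fun y => ?_) (fun b => ?_)
  · obtain ⟨s, rfl⟩ := hφ.surjective_onStates hX y
    exact onStates_eq_of_eq h s
  · obtain ⟨a, rfl⟩ := (hφ.bijective_onActions hX).2 b
    exact onActions_eq_of_eq h a

/-- In the pushout of `X⁰ → X` and `X⁰ → Y⁰`, a cocone is a map out of `X` together with an extension
of it to the states of `Y`, which is what `exists_extension` turns into a map out of `Y`. -/
theorem isPushout {X Y : CTS.{v, u} Lab} {φ : X ⟶ Y} (hφ : IsCSA2Reflection φ.hom) :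
    IsPushout ((stateInclusion.{v, u} Lab).app X) ((stateFunctor.{v, u} Lab).map φ) φ
      ((stateInclusion.{v, u} Lab).app Y) := by
  have hdesc : ∀ s : Limits.PushoutCocone ((stateInclusion.{v, u} Lab).app X)
      ((stateFunctor.{v, u} Lab).map φ),
      ∃ h : Y ⟶ s.pt, φ ≫ h = s.inl ∧ (stateInclusion.{v, u} Lab).app Y ≫ h = s.inr := by
    intro s
    have w := congrArg (fun k => k.hom) s.condition
    obtain ⟨h, h₁, h₂⟩ := hφ.exists_extension X.property s.inl.hom s.inr.hom.onStates
      fun x => (onStates_eq_of_eq w x).symm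
    refine ⟨ObjectProperty.homMk h, ?_, ?_⟩
    · ext : 1
      exact h₁
    · ext : 1
      exact WeakTransitionSystem.hom_ext (fun y => congrFun h₂ y) fun a => a.elim
  choose desc hl hr using hdesc
  have w := ((stateInclusion.{v, u} Lab).naturality φ).symm
  refine IsPushout.of_isColimit' ⟨w⟩ (Limits.PushoutCocone.IsColimit.mk w desc hl hr ?_)
  intro s m hm _
  ext : 1
  exact hφ.epi X.property (congrArg (fun k => k.hom) (hm.trans (hl s).symm))

end IsCSA2Reflection

/-- A reflection onto the systems satisfying CSA2 that takes cubical systems to regular ones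
restricts to a reflection of cubical systems onto regular ones. -/
noncomputable def restrictedAdjunction {L : WTS.{v, u} Lab ⥤ WTSCSA2.{v, u} Lab}
    (adj : L ⊣ (csa2.{v, u} Lab).ι)
    (hreg : ∀ X : CTS.{v, u} Lab, regular Lab (L.obj X.obj).obj) :
    (regular.{v, u} Lab).lift ((cubical.{v, u} Lab).ι ⋙ L ⋙ (csa2.{v, u} Lab).ι) hreg ⊣
      inclRTS.{v, u} Lab :=
  adj.restrictFullyFaithful (cubical.{v, u} Lab).fullyFaithfulι
    (ObjectProperty.fullyFaithfulιOfLE (P := regular.{v, u} Lab) (P' := csa2 Lab)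
      fun _ hX => hX.2)
    (Iso.refl _) (Iso.refl _)

theorem restrictedAdjunction_unit_app_hom {L : WTS.{v, u} Lab ⥤ WTSCSA2.{v, u} Lab}
    (adj : L ⊣ (csa2.{v, u} Lab).ι)
    (hreg : ∀ X : CTS.{v, u} Lab, regular Lab (L.obj X.obj).obj) (X : CTS.{v, u} Lab) :
    ((restrictedAdjunction adj hreg).unit.app X).hom = adj.unit.app X.obj := by
  have h := adj.map_restrictFullyFaithful_unit_app (cubical.{v, u} Lab).fullyFaithfulι
    (ObjectProperty.fullyFaithfulιOfLE (P := regular.{v, u} Lab) (P' := csa2 Lab)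
      fun _ hX => hX.2)
    (L := (regular.{v, u} Lab).lift
      ((cubical.{v, u} Lab).ι ⋙ L ⋙ (csa2.{v, u} Lab).ι) hreg) (R := inclRTS.{v, u} Lab)
    (Iso.refl _) (Iso.refl _) X
  refine h.trans ?_
  exact (congrArg (adj.unit.app X.obj ≫ ·)
    ((Category.comp_id _).trans ((csa2.{v, u} Lab).ι.map_id _))).trans (Category.comp_id _)

end WeakTransitionSystem

theorem mainTheorem10 (Lab : Type v) :
    -- a map one-to-one on states from a cubical system to a system satisfying CSA2
    (∀ (X Y : WTS.{v, u} Lab), cubical Lab X → csa2 Lab Y →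
      ∀ f : X ⟶ Y, Function.Injective f.onStates → regular Lab X) ∧
    -- the reflection of `WTS` onto the systems satisfying CSA2 exists, and can be chosen so that
    -- its unit at every cubical system is literally the identity on actions
    (∃ (L : WTS.{v, u} Lab ⥤ WTSCSA2.{v, u} Lab) (adj : L ⊣ (csa2.{v, u} Lab).ι),
      ∀ X : WTS.{v, u} Lab, cubical Lab X →
        ∃ h : X.Action = (L.obj X).obj.Action,
          ∀ u : X.Action, (adj.unit.app X).onActions u = cast h u) ∧
    -- for every choice of the reflection, i.e. of the functor `CSA₂ = L ⋙ ι : WTS ⥤ WTS`, with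
    -- unit `adj.unit`
    ∀ (L : WTS.{v, u} Lab ⥤ WTSCSA2.{v, u} Lab) (adj : L ⊣ (csa2.{v, u} Lab).ι),
      -- the unit at a cubical system is onto on states and bijective on actions
      (∀ X : WTS.{v, u} Lab, cubical Lab X →
        Function.Surjective (adj.unit.app X).onStates ∧
        Function.Bijective (adj.unit.app X).onActions) ∧
      -- `CSA₂` takes cubical (in particular regular) systems to regular ones
      (∀ X : WTS.{v, u} Lab, regular Lab X → regular Lab (L.obj X).obj) ∧
      ∃ hreg : ∀ X : CTS.{v, u} Lab, regular Lab (L.obj X.obj).obj,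
        -- `RTS` is a full isomorphism-closed subcategory of `CTS`, and it is reflective,
        -- the reflection and its unit being the restrictions of `CSA₂` and of its unit
        (inclRTS.{v, u} Lab).Full ∧ (inclRTS.{v, u} Lab).Faithful ∧
        (regular.{v, u} Lab).IsClosedUnderIsomorphisms ∧
        ∃ adjR : (regular.{v, u} Lab).lift
              ((cubical.{v, u} Lab).ι ⋙ L ⋙ (csa2.{v, u} Lab).ι) hreg ⊣ inclRTS.{v, u} Lab,
          (∀ X : CTS.{v, u} Lab, (adjR.unit.app X).hom = adj.unit.app X.obj) ∧
          -- the square `X⁰ → X`, `X⁰ → CSA₂(X)⁰` is a pushout square with corner `CSA₂(X)`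
          ∀ X : CTS.{v, u} Lab,
            IsPushout ((stateInclusion.{v, u} Lab).app X)
              ((stateFunctor.{v, u} Lab).map (adjR.unit.app X))
              (adjR.unit.app X)
              ((stateInclusion.{v, u} Lab).app _) := by
  refine ⟨fun X Y hX hY f hf => regular_of_injective_onStates hX hY f hf,
    ⟨csa2Reflector Lab, csa2Adjunction Lab,
      fun X _ => ⟨rfl, fun a => onActions_csa2Adjunction_unit X a⟩⟩, fun L adj => ?_⟩
  have hrefl := isCSA2Reflection_unit adj
  have hreg : ∀ X : CTS.{v, u} Lab, regular Lab (L.obj X.obj).obj :=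
    fun X => (hrefl X.obj).regular_target X.property
  refine ⟨fun X hX => ⟨(hrefl X).surjective_onStates hX, (hrefl X).bijective_onActions hX⟩,
    fun X hX => (hrefl X).regular_target (regular_le_cubical X hX), hreg,
    inferInstance, inferInstance, inferInstance, restrictedAdjunction adj hreg,
    restrictedAdjunction_unit_app_hom adj hreg, fun X => IsCSA2Reflection.isPushout ?_⟩
  rw [restrictedAdjunction_unit_app_hom]
  exact hrefl X.obj
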